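/- For complex numbers $x,q$ with $|q|<1$ write $(x;q)_n=\prod_{k=0}^{n-1}(1-xq^k)$, $(x;q)_\infty=\prod_{k=0}^{\infty}(1-xq^k)$, and $(x_1,\dots,x_m;q)_n=(x_1;q)_n\cdots(x_m;q)_n$ for $n\in\{0,1,2,\dots\}\cup\{\infty\}$. **Theorem.** Let $q,a,b\in\mathbb C$ with $|q|<1$ and $\max\{|aq^2|,|bq^2|,|ab|\}<1$. Then the three series below converge absolutely and $$ \begin{aligned} &\frac{(q^4,ab;q^2)_\infty}{(-q^2,aq^2,bq^2;q^2)_\infty\,(q^2;q^4)_\infty} \sum_{n=0}^{\infty}\frac{(q^2/a,q^2/b;q^2)_n}{(q^2,q^3,-q^3;q^2)_n}\,a^nb^n\\ &\quad=\sum_{n=0}^{\infty}(-1)^n\frac{(q^2/a,q^2/b;q^2)_{2n}}{(aq^2,bq^2;q^2)_{2n}}\,a^{2n}b^{2n}q^{6n^2+2n} -\sum_{n=0}^{\infty}(-1)^n\frac{(q^2/a,q^2/b;q^2)_{2n+1}}{(aq^2,bq^2;q^2)_{2n+1}}\,a^{2n+1}b^{2n+1}q^{6n^2+10n+4}. \end{aligned}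 $$ Here, if $a=0$, the product $(q^2/a;q^2)_m\,a^m$ is understood as its limit $(-1)^mq^{m(m+1)}$ as $a\to0$, and likewise for $b=0$; also $0^0=1$. -/

import Mathlib

/-- The finite `q`-shifted factorial `(a; q)_n = ∏_{k=0}^{n-1} (1 - a q^k)`. -/
noncomputable def qPoch (a q : ℂ) (n : ℕ) : ℂ :=
  ∏ k ∈ Finset.range n, (1 - a * q ^ k)

/-- The infinite `q`-shifted factorial `(a; q)_∞ = ∏_{k=0}^∞ (1 - a q^k)`. -/
noncomputable def qPochInf (a q : ℂ) : ℂ :=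
  ∏' k : ℕ, (1 - a * q ^ k)

/-- For `|q| < 1` the infinite product `(a; q)_∞` converges. -/
theorem multipliable_qPochInf (a : ℂ) {q : ℂ} (hq : ‖q‖ < 1) :
    Multipliable (fun k : ℕ => 1 - a * q ^ k) := by
  have h : Summable (fun k : ℕ => ‖-(a * q ^ k)‖) := by
    simpa using (summable_geometric_of_lt_one (norm_nonneg q) hq).mul_left ‖a‖
  simpa [sub_eq_add_neg] using multipliable_one_add_of_summable h

/-- The quantity `(q²/a; q²)_n aⁿ`. At `a = 0` it stands for its limit as `a → 0`, which is
`(-1)ⁿ q^{n(n+1)}`. -/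
noncomputable def qPochPow (q a : ℂ) (n : ℕ) : ℂ :=
  if a = 0 then (-1) ^ n * q ^ (n * (n + 1)) else qPoch (q ^ 2 / a) (q ^ 2) n * a ^ n

/-- `(q²/a; q²)_n aⁿ = ∏_{k=0}^{n-1} (a - q^{2k+2})`, including the limiting value at `a = 0`. -/
theorem qPochPow_eq_prod (q a : ℂ) (n : ℕ) :
    qPochPow q a n = ∏ k ∈ Finset.range n, (a - q ^ (2 * k + 2)) := by
  unfold qPochPow
  split_ifs with h
  · subst h
    induction n with
    | zero => simp
    | succ n ih =>
      rw [Finset.prod_range_succ, ← ih]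
      ring
  · rw [qPoch, show a ^ n = ∏ _k ∈ Finset.range n, a by simp,
      ← Finset.prod_mul_distrib]
    refine Finset.prod_congr rfl fun k _ => ?_
    field_simp
    ring

/-- The value of `(q²/a; q²)_n aⁿ` used at `a = 0` is its limit as `a → 0`. -/
theorem tendsto_qPochPow_zero (q : ℂ) (n : ℕ) :
    Filter.Tendsto (fun a : ℂ => qPoch (q ^ 2 / a) (q ^ 2) n * a ^ n)
      (nhdsWithin 0 {0}ᶜ) (nhds ((-1) ^ n * q ^ (n * (n + 1)))) := by
  have hc : Continuous (fun a : ℂ => qPochPow q a n) := by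
    simp only [qPochPow_eq_prod]
    fun_prop
  have h := (hc.tendsto 0).mono_left (nhdsWithin_le_nhds (s := {0}ᶜ))
  have h0 : qPochPow q 0 n = (-1) ^ n * q ^ (n * (n + 1)) := if_pos rfl
  rw [h0] at h
  refine h.congr' ?_
  filter_upwards [self_mem_nhdsWithin] with a ha
  exact if_neg ha

/-!
Write `p = q²`. The series on the left is `∑ (p/a, p/b; p)_n aⁿbⁿ β_n` with
`β_n = 1 / ((p; p)_n (p³; p²)_n)`, and the right-hand side is the other half of Bailey's lemma for a
Bailey pair `(α, β)` relative to `p`; Bailey's lemma itself is the `q`-Gauss sum inside a double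
series.

That `(α, β)` is a Bailey pair amounts to evaluating the bilateral sum
`∑_j (-1)^j p^(3j² + j) / ((p; p)_{n-2j} (p; p)_{n+1+2j})`. It belongs to the family
`T(s; k, l) = ∑_j (-1)^j p^(3j² + sj) / ((p; p)_{k-2j} (p; p)_{l+2j})`, in which lowering `k` or `l`
by one shifts `s` by two. The reflections `j ↦ -j` and `j ↦ -1 - j` exchange `k` and `l`, and the
second one forces `T(3; k, k + 2) = 0`; together these relations give a first-order recurrence in
`n`.

The symbols `(c/a; q)_n aⁿ` are treated throughout as polynomials in `a`, which absorbs the limiting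
cases `a = 0` and `b = 0`.
-/

open Filter Topology Finset

section ShiftedFactorial

theorem mul_pow_ne_one {𝕜 : Type*} [NormedField 𝕜] {x q : 𝕜} (hx : ‖x‖ < 1) (hq : ‖q‖ ≤ 1)
    (k : ℕ) : x * q ^ k ≠ 1 := by
  refine ne_of_apply_ne norm (ne_of_lt ?_)
  rw [norm_mul, norm_pow, norm_one]
  exact (mul_le_of_le_one_right (norm_nonneg x) (pow_le_one₀ (norm_nonneg q) hq)).trans_lt hx

theorem qPoch_zero (x q : ℂ) : qPoch x q 0 = 1 := prod_range_zero _

theorem qPoch_succ (x q : ℂ) (n : ℕ) : qPoch x q (n + 1) = qPoch x q n * (1 - x * q ^ n) :=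
  prod_range_succ _ _

theorem qPoch_add (x q : ℂ) (m n : ℕ) :
    qPoch x q (m + n) = qPoch x q m * qPoch (x * q ^ m) q n := by
  simp only [qPoch, prod_range_add, pow_add, mul_assoc]

theorem qPoch_succ' (x q : ℂ) (n : ℕ) : qPoch x q (n + 1) = (1 - x) * qPoch (x * q) q n := by
  rw [add_comm, qPoch_add, qPoch_succ, qPoch_zero, pow_zero, pow_one, mul_one, one_mul]

theorem qPoch_mul_qPoch_neg (x q : ℂ) (n : ℕ) :
    qPoch x q n * qPoch (-x) q n = qPoch (x ^ 2) (q ^ 2) n := by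
  simp only [qPoch, ← prod_mul_distrib]
  exact prod_congr rfl fun k _ => by ring

theorem qPoch_ne_zero {x q : ℂ} (hx : ∀ k : ℕ, x * q ^ k ≠ 1) (n : ℕ) : qPoch x q n ≠ 0 :=
  prod_ne_zero_iff.mpr fun k _ => sub_ne_zero.mpr (hx k).symm

theorem tendsto_qPoch (x : ℂ) {q : ℂ} (hq : ‖q‖ < 1) :
    Tendsto (qPoch x q) atTop (𝓝 (qPochInf x q)) :=
  (multipliable_qPochInf x hq).hasProd.tendsto_prod_nat

theorem qPochInf_zero_left (q : ℂ) : qPochInf 0 q = 1 := by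
  simp only [qPochInf, zero_mul, sub_zero, tprod_one]

theorem qPoch_mul_qPochInf (x : ℂ) {q : ℂ} (hq : ‖q‖ < 1) (n : ℕ) :
    qPoch x q n * qPochInf (x * q ^ n) q = qPochInf x q := by
  have hshift : Multipliable fun k : ℕ => 1 - x * q ^ (k + n) :=
    (multipliable_qPochInf (x * q ^ n) hq).congr fun k => by ring
  have htail : qPochInf (x * q ^ n) q = ∏' k : ℕ, (1 - x * q ^ (k + n)) :=
    tprod_congr fun k => by ring
  rw [htail]
  exact Multipliable.prod_mul_tprod_nat_mul' (f := fun k => 1 - x * q ^ k) hshift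

theorem qPochInf_ne_zero {x q : ℂ} (hx : ∀ k : ℕ, x * q ^ k ≠ 1) (hq : ‖q‖ < 1) :
    qPochInf x q ≠ 0 := by
  have hsum : Summable fun k : ℕ => ‖-(x * q ^ k)‖ := by
    simpa only [norm_neg, norm_mul, norm_pow] using
      (summable_geometric_of_lt_one (norm_nonneg q) hq).mul_left ‖x‖
  simpa only [qPochInf, sub_eq_add_neg] using tprod_one_add_ne_zero_of_summable
    (fun k => by rw [← sub_eq_add_neg]; exact sub_ne_zero.mpr (hx k).symm) hsum

theorem exists_norm_inv_qPoch_le {x q : ℂ} (hx : ∀ k : ℕ, x * q ^ k ≠ 1) (hq : ‖q‖ < 1) :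
    ∃ K, ∀ n, ‖(qPoch x q n)⁻¹‖ ≤ K := by
  obtain ⟨K, hK⟩ := ((tendsto_qPoch x hq).inv₀ (qPochInf_ne_zero hx hq)).norm.bddAbove_range
  exact ⟨K, fun n => hK ⟨n, rfl⟩⟩

theorem exists_norm_inv_qPoch_mul_inv_qPoch_le {x y q r : ℂ} (hx : ∀ k : ℕ, x * q ^ k ≠ 1)
    (hy : ∀ k : ℕ, y * r ^ k ≠ 1) (hq : ‖q‖ < 1) (hr : ‖r‖ < 1) :
    ∃ K, ∀ m n, ‖(qPoch x q m)⁻¹ * (qPoch y r n)⁻¹‖ ≤ K := by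
  obtain ⟨K, hK⟩ := exists_norm_inv_qPoch_le hx hq
  obtain ⟨L, hL⟩ := exists_norm_inv_qPoch_le hy hr
  refine ⟨K * L, fun m n => ?_⟩
  rw [norm_mul]
  exact mul_le_mul (hK m) (hL n) (norm_nonneg _) ((norm_nonneg _).trans (hK m))

theorem norm_sq_lt_one {𝕜 : Type*} [NormedField 𝕜] {q : 𝕜} (hq : ‖q‖ < 1) : ‖q ^ 2‖ < 1 := by
  rw [norm_pow]
  exact pow_lt_one₀ (norm_nonneg q) hq two_ne_zero

theorem qPochInf_mul_qPochInf_neg (x : ℂ) {q : ℂ} (hq : ‖q‖ < 1) :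
    qPochInf x q * qPochInf (-x) q = qPochInf (x ^ 2) (q ^ 2) := by
  rw [qPochInf, qPochInf,
    ← (multipliable_qPochInf x hq).tprod_mul (multipliable_qPochInf (-x) hq)]
  exact tprod_congr fun k => by ring

theorem qPochInf_even_mul_odd (x : ℂ) {q : ℂ} (hq : ‖q‖ < 1) :
    qPochInf x (q ^ 2) * qPochInf (x * q) (q ^ 2) = qPochInf x q := by
  have heven : ∀ k : ℕ, 1 - x * q ^ (2 * k) = 1 - x * (q ^ 2) ^ k := fun k => by ring
  have hodd : ∀ k : ℕ, 1 - x * q ^ (2 * k + 1) = 1 - x * q * (q ^ 2) ^ k := fun k => by ring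
  have hq2 := norm_sq_lt_one hq
  have h := tprod_even_mul_odd (f := fun k => 1 - x * q ^ k)
    ((multipliable_qPochInf x hq2).congr fun k => (heven k).symm)
    ((multipliable_qPochInf (x * q) hq2).congr fun k => (hodd k).symm)
  simp only [heven, hodd] at h
  exact h

/-- Euler's identity: partitions into distinct parts are equinumerous with partitions into odd
parts. -/
theorem qPochInf_neg_mul_qPochInf_sq {q : ℂ} (hq : ‖q‖ < 1) :
    qPochInf (-q) q * qPochInf q (q ^ 2) = 1 := by
  have hq2 := norm_sq_lt_one hq
  have hpm := qPochInf_mul_qPochInf_neg q hq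
  rw [← qPochInf_even_mul_odd q hq, ← pow_two] at hpm
  apply mul_right_cancel₀ (qPochInf_ne_zero (mul_pow_ne_one hq2 hq2.le) hq2)
  linear_combination hpm

end ShiftedFactorial

section HomogeneousFactorial

/-- The homogeneous `q`-shifted factorial `(c/a; q)_n aⁿ`, written as `∏_{k<n} (a - c q^k)` so that
it also makes sense for `a = 0`. -/
def homPoch {R : Type*} [CommRing R] (c a q : R) (n : ℕ) : R := ∏ k ∈ range n, (a - c * q ^ k)

section Algebra

variable {R : Type*} [CommRing R]

theorem homPoch_zero (c a q : R) : homPoch c a q 0 = 1 := prod_range_zero _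

theorem homPoch_succ (c a q : R) (n : ℕ) :
    homPoch c a q (n + 1) = homPoch c a q n * (a - c * q ^ n) := prod_range_succ _ _

theorem homPoch_add (c a q : R) (m n : ℕ) :
    homPoch c a q (m + n) = homPoch c a q m * homPoch (c * q ^ m) a q n := by
  simp only [homPoch, prod_range_add, pow_add, mul_assoc]

theorem homPoch_mul_succ (c a q : R) (n : ℕ) :
    homPoch c (a * q) q (n + 1) = q ^ n * (a * q - c) * homPoch c a q n := by
  induction n with
  | zero => simp only [homPoch_succ, homPoch_zero]; ring
  | succ n ih => rw [homPoch_succ, ih, homPoch_succ]; ring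

theorem homPoch_self_succ (c q : R) (n : ℕ) : homPoch c c q (n + 1) = 0 :=
  prod_eq_zero (mem_range.mpr n.succ_pos) (by rw [pow_zero, mul_one, sub_self])

theorem continuous_homPoch [TopologicalSpace R] [IsTopologicalRing R] (c q : R) (n : ℕ) :
    Continuous fun a => homPoch c a q n := by
  unfold homPoch
  fun_prop

end Algebra

theorem qPochPow_eq_homPoch (q a : ℂ) (n : ℕ) :
    qPochPow q a n = homPoch (q ^ 2) a (q ^ 2) n := by
  rw [qPochPow_eq_prod, homPoch]
  exact prod_congr rfl fun k _ => by ring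

theorem summable_prod_range_of_tendsto_norm_lt_one {R : Type*} [NormedCommRing R]
    [CompleteSpace R] {g : ℕ → R} {L : ℝ} (hg : Tendsto (fun k => ‖g k‖) atTop (𝓝 L)) (hL : L < 1) :
    Summable fun n => ∏ k ∈ range n, g k := by
  obtain ⟨r, hLr, hr⟩ := exists_between hL
  refine summable_of_ratio_norm_eventually_le hr ?_
  filter_upwards [hg.eventually (eventually_le_nhds hLr)] with n hn
  rw [prod_range_succ, mul_comm r]
  exact (norm_mul_le _ _).trans (mul_le_mul_of_nonneg_left hn (norm_nonneg _))

theorem norm_homPoch_le {𝕜 : Type*} [NormedField 𝕜] {c a q : 𝕜} {C A : ℝ} (hc : ‖c‖ ≤ C)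
    (ha : ‖a‖ ≤ A) (n : ℕ) : ‖homPoch c a q n‖ ≤ ∏ k ∈ range n, (A + C * ‖q‖ ^ k) := by
  rw [homPoch, norm_prod]
  refine prod_le_prod (fun _ _ => norm_nonneg _) fun k _ => (norm_sub_le _ _).trans ?_
  rw [norm_mul, norm_pow]
  gcongr

theorem exists_summable_norm_homPoch_mul_homPoch_le {𝕜 : Type*} [NormedField 𝕜] {q a b : 𝕜}
    (hq : ‖q‖ < 1) (hab : ‖a * b‖ < 1) (c d : 𝕜) :
    ∃ g : ℕ → ℝ, Summable g ∧ ∀ {a' b' c' d' : 𝕜}, ‖a'‖ ≤ ‖a‖ → ‖b'‖ ≤ ‖b‖ → ‖c'‖ ≤ ‖c‖ →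
      ‖d'‖ ≤ ‖d‖ → ∀ n, ‖homPoch c' a' q n * homPoch d' b' q n‖ ≤ g n := by
  have hlim (x y : 𝕜) : Tendsto (fun k : ℕ => ‖x‖ + ‖y‖ * ‖q‖ ^ k) atTop (𝓝 ‖x‖) := by
    simpa only [mul_zero, add_zero] using
      ((tendsto_pow_atTop_nhds_zero_of_lt_one (norm_nonneg q) hq).const_mul ‖y‖).const_add ‖x‖
  refine ⟨fun n => ∏ k ∈ range n, (‖a‖ + ‖c‖ * ‖q‖ ^ k) * (‖b‖ + ‖d‖ * ‖q‖ ^ k),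
    summable_prod_range_of_tendsto_norm_lt_one ((hlim a c).mul (hlim b d)).norm
      (by rwa [← norm_mul, norm_norm]), fun ha hb hc hd n => ?_⟩
  simp only [norm_mul, prod_mul_distrib]
  exact mul_le_mul (norm_homPoch_le hc ha n) (norm_homPoch_le hd hb n) (norm_nonneg _)
    (prod_nonneg fun k _ => by positivity)

theorem summable_homPoch_mul_homPoch_mul {𝕜 : Type*} [NormedField 𝕜] [CompleteSpace 𝕜]
    {q a b : 𝕜} (hq : ‖q‖ < 1) (hab : ‖a * b‖ < 1) (c d : 𝕜) {w : ℕ → 𝕜} {K : ℝ}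
    (hw : ∀ n, ‖w n‖ ≤ K) : Summable fun n => homPoch c a q n * homPoch d b q n * w n := by
  obtain ⟨g, hg, hle⟩ := exists_summable_norm_homPoch_mul_homPoch_le hq hab c d
  refine (hg.mul_right K).of_norm_bounded fun n => ?_
  have hn := hle le_rfl le_rfl le_rfl le_rfl n
  rw [norm_mul]
  exact mul_le_mul hn (hw n) (norm_nonneg _) ((norm_nonneg _).trans hn)

end HomogeneousFactorial

section Gauss

/-- The terms `(c/a, d/b; q)_m (ab)^m / (q, cd; q)_m` of the `q`-Gauss series. -/
noncomputable def gaussTerm (c d q a b : ℂ) (m : ℕ) : ℂ :=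
  homPoch c a q m * homPoch d b q m * ((qPoch q q m)⁻¹ * (qPoch (c * d) q m)⁻¹)

variable {a b c d q : ℂ}

theorem gaussTerm_swap (c d q a b : ℂ) : gaussTerm c d q a b = gaussTerm d c q b a := by
  funext m
  rw [gaussTerm, gaussTerm, mul_comm (homPoch c a q m), mul_comm c]

theorem gaussTerm_succ_mul (hq : ∀ k : ℕ, q * q ^ k ≠ 1) (hcd : ∀ k : ℕ, c * d * q ^ k ≠ 1)
    (a b : ℂ) (m : ℕ) :
    gaussTerm c d q a b (m + 1) * ((1 - q * q ^ m) * (1 - c * d * q ^ m)) =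
      (a - c * q ^ m) * (b - d * q ^ m) * gaussTerm c d q a b m := by
  have hqm : 1 - q * q ^ m ≠ 0 := sub_ne_zero.mpr (hq m).symm
  have hcdm : 1 - c * d * q ^ m ≠ 0 := sub_ne_zero.mpr (hcd m).symm
  rw [gaussTerm, gaussTerm, homPoch_succ, homPoch_succ, qPoch_succ, qPoch_succ, mul_inv, mul_inv]
  generalize 1 - q * q ^ m = x at *
  generalize 1 - c * d * q ^ m = y at *
  field_simp

theorem gaussTerm_mul_succ_mul (hq : ∀ k : ℕ, q * q ^ k ≠ 1) (hcd : ∀ k : ℕ, c * d * q ^ k ≠ 1)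
    (a b : ℂ) (m : ℕ) :
    gaussTerm c d q (a * q) b (m + 1) * ((1 - q * q ^ m) * (1 - c * d * q ^ m)) =
      q ^ m * (a * q - c) * (b - d * q ^ m) * gaussTerm c d q a b m := by
  have hqm : 1 - q * q ^ m ≠ 0 := sub_ne_zero.mpr (hq m).symm
  have hcdm : 1 - c * d * q ^ m ≠ 0 := sub_ne_zero.mpr (hcd m).symm
  rw [gaussTerm, gaussTerm, homPoch_mul_succ, homPoch_succ, qPoch_succ, qPoch_succ, mul_inv,
    mul_inv]
  generalize 1 - q * q ^ m = x at *
  generalize 1 - c * d * q ^ m = y at *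
  field_simp

theorem sum_range_succ_gaussTerm_sub (hq : ∀ k : ℕ, q * q ^ k ≠ 1)
    (hcd : ∀ k : ℕ, c * d * q ^ k ≠ 1) (a b : ℂ) (M : ℕ) :
    ∑ m ∈ range (M + 1),
      ((1 - a * b) * gaussTerm c d q a b m - (1 - a * d) * gaussTerm c d q (a * q) b m) =
    -a * (b - d * q ^ M) * gaussTerm c d q a b M := by
  induction M with
  | zero =>
    simp only [zero_add, sum_range_one, gaussTerm, homPoch_zero, qPoch_zero, pow_zero]
    ring
  | succ M ih =>
    have hden : (1 - q * q ^ M) * (1 - c * d * q ^ M) ≠ 0 :=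
      mul_ne_zero (sub_ne_zero.mpr (hq M).symm) (sub_ne_zero.mpr (hcd M).symm)
    rw [sum_range_succ, ih]
    apply mul_right_cancel₀ hden
    linear_combination
      (1 - a * b + a * (b - d * q ^ (M + 1))) * gaussTerm_succ_mul hq hcd a b M -
        (1 - a * d) * gaussTerm_mul_succ_mul hq hcd a b M

theorem summable_gaussTerm (hq : ‖q‖ < 1) (hcd : ∀ k : ℕ, c * d * q ^ k ≠ 1)
    (hab : ‖a * b‖ < 1) : Summable (gaussTerm c d q a b) := by
  obtain ⟨K, hK⟩ := exists_norm_inv_qPoch_mul_inv_qPoch_le (mul_pow_ne_one hq hq.le) hcd hq hq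
  exact summable_homPoch_mul_homPoch_mul hq hab c d fun n => hK n n

theorem tsum_gaussTerm_contiguous (hq : ‖q‖ < 1) (hcd : ∀ k : ℕ, c * d * q ^ k ≠ 1)
    (hab : ‖a * b‖ < 1) :
    (1 - a * b) * ∑' m, gaussTerm c d q a b m =
      (1 - a * d) * ∑' m, gaussTerm c d q (a * q) b m := by
  have habq : ‖a * q * b‖ < 1 := by
    rw [mul_right_comm, norm_mul]
    exact mul_lt_one_of_nonneg_of_lt_one_left (norm_nonneg _) hab hq.le
  have hs := summable_gaussTerm hq hcd hab
  have hpartial := (tendsto_add_atTop_iff_nat 1).mpr ((hs.hasSum.mul_left (1 - a * b)).sub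
    ((summable_gaussTerm hq hcd habq).hasSum.mul_left (1 - a * d))).tendsto_sum_nat
  simp only [sum_range_succ_gaussTerm_sub (mul_pow_ne_one hq hq.le) hcd] at hpartial
  have hboundary := (((tendsto_pow_atTop_nhds_zero_of_norm_lt_one hq).const_mul d).const_sub b
    |>.const_mul (-a)).mul hs.tendsto_atTop_zero
  rw [mul_zero] at hboundary
  exact sub_eq_zero.mp (tendsto_nhds_unique hpartial hboundary)

theorem qPoch_mul_tsum_gaussTerm (hq : ‖q‖ < 1) (hcd : ∀ k : ℕ, c * d * q ^ k ≠ 1)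
    (hab : ‖a * b‖ < 1) (n : ℕ) :
    qPoch (a * b) q n * ∑' m, gaussTerm c d q a b m =
      qPoch (a * d) q n * ∑' m, gaussTerm c d q (a * q ^ n) b m := by
  induction n with
  | zero => simp only [qPoch_zero, pow_zero, mul_one]
  | succ n ih =>
    have habn : ‖a * q ^ n * b‖ < 1 := by
      rw [mul_right_comm, norm_mul, norm_pow]
      exact mul_lt_one_of_nonneg_of_lt_one_left (norm_nonneg _) hab
        (pow_le_one₀ (norm_nonneg q) hq.le)
    have hstep := tsum_gaussTerm_contiguous hq hcd habn
    rw [qPoch_succ, qPoch_succ, pow_succ, ← mul_assoc a]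
    linear_combination (1 - a * b * q ^ n) * ih + qPoch (a * d) q n * hstep

theorem tendsto_tsum_gaussTerm_mul_pow (hq : ‖q‖ < 1) (hcd : ∀ k : ℕ, c * d * q ^ k ≠ 1)
    (hab : ‖a * b‖ < 1) :
    Tendsto (fun n : ℕ => ∑' m, gaussTerm c d q (a * q ^ n) b m) atTop
      (𝓝 (∑' m, gaussTerm c d q 0 b m)) := by
  obtain ⟨g, hg, hle⟩ := exists_summable_norm_homPoch_mul_homPoch_le hq hab c d
  obtain ⟨K, hK⟩ := exists_norm_inv_qPoch_mul_inv_qPoch_le (mul_pow_ne_one hq hq.le) hcd hq hq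
  have harg : Tendsto (fun n : ℕ => a * q ^ n) atTop (𝓝 0) := by
    simpa only [mul_zero] using (tendsto_pow_atTop_nhds_zero_of_norm_lt_one hq).const_mul a
  refine tendsto_tsum_of_dominated_convergence (hg.mul_right K) (fun m => ?_)
    (Eventually.of_forall fun n m => ?_)
  · have hcont : Continuous fun x => gaussTerm c d q x b m :=
      ((continuous_homPoch c q m).mul_const _).mul_const _
    exact (hcont.tendsto 0).comp harg
  · have hnorm : ‖a * q ^ n‖ ≤ ‖a‖ := by
      rw [norm_mul, norm_pow]
      exact mul_le_of_le_one_right (norm_nonneg a) (pow_le_one₀ (norm_nonneg q) hq.le)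
    have hm := hle hnorm le_rfl le_rfl le_rfl m
    rw [gaussTerm, norm_mul]
    exact mul_le_mul hm (hK m m) (norm_nonneg _) ((norm_nonneg _).trans hm)

theorem qPochInf_mul_tsum_gaussTerm (hq : ‖q‖ < 1) (hcd : ∀ k : ℕ, c * d * q ^ k ≠ 1)
    (hab : ‖a * b‖ < 1) :
    qPochInf (a * b) q * ∑' m, gaussTerm c d q a b m =
      qPochInf (a * d) q * ∑' m, gaussTerm c d q 0 b m := by
  have hlim := (tendsto_qPoch (a * b) hq).mul_const (∑' m, gaussTerm c d q a b m)
  simp only [qPoch_mul_tsum_gaussTerm hq hcd hab] at hlim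
  exact tendsto_nhds_unique hlim
    ((tendsto_qPoch (a * d) hq).mul (tendsto_tsum_gaussTerm_mul_pow hq hcd hab))

theorem tsum_gaussTerm_self (c d q b : ℂ) : ∑' m, gaussTerm c d q c b m = 1 := by
  rw [tsum_eq_single 0]
  · simp only [gaussTerm, homPoch_zero, qPoch_zero, inv_one, mul_one]
  · intro m hm
    obtain ⟨k, rfl⟩ := Nat.exists_eq_succ_of_ne_zero hm
    rw [gaussTerm, homPoch_self_succ, zero_mul, zero_mul]

theorem tsum_gaussTerm_zero_left (hq : ‖q‖ < 1) (hcd : ∀ k : ℕ, c * d * q ^ k ≠ 1) (b : ℂ) :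
    ∑' m, gaussTerm c d q 0 b m = qPochInf (b * c) q * ∑' m, gaussTerm c d q 0 0 m := by
  have h := qPochInf_mul_tsum_gaussTerm (a := b) (b := 0) hq
    (by simpa only [mul_comm c] using hcd) (by rw [mul_zero, norm_zero]; exact one_pos)
  rwa [mul_zero, qPochInf_zero_left, one_mul, gaussTerm_swap, gaussTerm_swap d] at h

/-- The `q`-Gauss sum. Two applications of the contiguous relation reduce it to `a = b = 0`, and
the terminating case `a = c`, `b = 0` supplies the constant. -/
theorem hasSum_gaussTerm (hq : ‖q‖ < 1) (hcd : ∀ k : ℕ, c * d * q ^ k ≠ 1)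
    (hab : ‖a * b‖ < 1) :
    HasSum (gaussTerm c d q a b)
      (qPochInf (a * d) q * qPochInf (b * c) q / (qPochInf (c * d) q * qPochInf (a * b) q)) := by
  have hconst : qPochInf (c * d) q * ∑' m, gaussTerm c d q 0 0 m = 1 := by
    rw [← qPochInf_mul_tsum_gaussTerm hq hcd (by rw [mul_zero, norm_zero]; exact one_pos),
      tsum_gaussTerm_self, mul_zero, qPochInf_zero_left, one_mul]
  have hab0 := qPochInf_ne_zero (mul_pow_ne_one hab hq.le) hq
  have hreduce := qPochInf_mul_tsum_gaussTerm hq hcd hab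
  rw [tsum_gaussTerm_zero_left hq hcd] at hreduce
  convert (summable_gaussTerm hq hcd hab).hasSum using 1
  rw [div_eq_iff (mul_ne_zero (qPochInf_ne_zero hcd hq) hab0)]
  linear_combination -(qPochInf (c * d) q) * hreduce -
    qPochInf (a * d) q * qPochInf (b * c) q * hconst

end Gauss

section BaileyLemma

/-- `(α, β)` is a Bailey pair relative to `x` (with base `q`):
`β_n = ∑_{r ≤ n} α_r / ((q; q)_{n-r} (xq; q)_{n+r})`. -/
def IsBaileyPair (x q : ℂ) (α β : ℕ → ℂ) : Prop :=
  ∀ n, β n = ∑ r ∈ range (n + 1), α r * ((qPoch q q (n - r))⁻¹ * (qPoch (x * q) q (n + r))⁻¹)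

/-- The `(r, m)` term of the double series in the proof of Bailey's lemma, where `m = n - r`. -/
noncomputable def baileyTerm (α : ℕ → ℂ) (c d q a b : ℂ) (r m : ℕ) : ℂ :=
  homPoch c a q (r + m) * homPoch d b q (r + m) *
    (α r * ((qPoch q q m)⁻¹ * (qPoch (c * d) q (2 * r + m))⁻¹))

variable {a b c d q x : ℂ} {α β : ℕ → ℂ}

theorem baileyTerm_eq_mul_gaussTerm (α : ℕ → ℂ) (c d q a b : ℂ) (r m : ℕ) :
    baileyTerm α c d q a b r m =
      homPoch c a q r * homPoch d b q r * α r * (qPoch (c * d) q (2 * r))⁻¹ *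
        gaussTerm (c * q ^ r) (d * q ^ r) q a b m := by
  rw [baileyTerm, gaussTerm, homPoch_add, homPoch_add, qPoch_add,
    show c * d * q ^ (2 * r) = c * q ^ r * (d * q ^ r) by ring, mul_inv]
  ring

theorem IsBaileyPair.sum_antidiagonal_baileyTerm (h : IsBaileyPair x q α β) (hcd : c * d = x * q)
    (a b : ℂ) (n : ℕ) :
    ∑ p ∈ antidiagonal n, baileyTerm α c d q a b p.1 p.2 =
      homPoch c a q n * homPoch d b q n * β n := by
  rw [Nat.sum_antidiagonal_eq_sum_range_succ (baileyTerm α c d q a b), h n, mul_sum]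
  refine sum_congr rfl fun r hr => ?_
  have hrn : r ≤ n := mem_range_succ_iff.mp hr
  rw [baileyTerm, hcd, Nat.add_sub_cancel' hrn, show 2 * r + (n - r) = n + r by omega]

theorem hasSum_baileyTerm (hq : ‖q‖ < 1) (hcd : ∀ k : ℕ, c * d * q ^ k ≠ 1)
    (had : ∀ k : ℕ, a * d * q ^ k ≠ 1) (hbc : ∀ k : ℕ, b * c * q ^ k ≠ 1) (hab : ‖a * b‖ < 1)
    (α : ℕ → ℂ) (r : ℕ) :
    HasSum (baileyTerm α c d q a b r)
      (qPochInf (a * d) q * qPochInf (b * c) q / (qPochInf (c * d) q * qPochInf (a * b) q) *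
        (homPoch c a q r * homPoch d b q r * α r *
          ((qPoch (a * d) q r)⁻¹ * (qPoch (b * c) q r)⁻¹))) := by
  have hshift : c * q ^ r * (d * q ^ r) = c * d * q ^ (2 * r) := by ring
  have hgauss : HasSum (gaussTerm (c * q ^ r) (d * q ^ r) q a b) _ :=
    hasSum_gaussTerm hq (fun k => by
      rw [hshift, mul_assoc, ← pow_add]; exact hcd (2 * r + k)) hab
  rw [hshift, ← mul_assoc a, ← mul_assoc b] at hgauss
  have hvalue : qPochInf (a * d) q * qPochInf (b * c) q /
      (qPochInf (c * d) q * qPochInf (a * b) q) *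
        (homPoch c a q r * homPoch d b q r * α r *
          ((qPoch (a * d) q r)⁻¹ * (qPoch (b * c) q r)⁻¹)) =
      homPoch c a q r * homPoch d b q r * α r * (qPoch (c * d) q (2 * r))⁻¹ *
        (qPochInf (a * d * q ^ r) q * qPochInf (b * c * q ^ r) q /
          (qPochInf (c * d * q ^ (2 * r)) q * qPochInf (a * b) q)) := by
    rw [← qPoch_mul_qPochInf (a * d) hq r, ← qPoch_mul_qPochInf (b * c) hq r,
      ← qPoch_mul_qPochInf (c * d) hq (2 * r)]
    have hadr := qPoch_ne_zero had r
    have hbcr := qPoch_ne_zero hbc r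
    field_simp
  rw [funext (baileyTerm_eq_mul_gaussTerm α c d q a b r), hvalue]
  exact hgauss.mul_left _

theorem summable_baileyTerm (hq : ‖q‖ < 1) (hcd : ∀ k : ℕ, c * d * q ^ k ≠ 1)
    (hab : ‖a * b‖ < 1) (hα : Summable fun r => homPoch c a q r * homPoch d b q r * α r) :
    Summable fun p : ℕ × ℕ => baileyTerm α c d q a b p.1 p.2 := by
  obtain ⟨g, hg, hle⟩ := exists_summable_norm_homPoch_mul_homPoch_le hq hab c d
  obtain ⟨K, hK⟩ := exists_norm_inv_qPoch_mul_inv_qPoch_le (mul_pow_ne_one hq hq.le) hcd hq hq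
  have hg0 : 0 ≤ g := fun m => (norm_nonneg _).trans (hle le_rfl le_rfl le_rfl le_rfl m)
  have hpow (y : ℂ) (r : ℕ) : ‖y * q ^ r‖ ≤ ‖y‖ := by
    rw [norm_mul, norm_pow]
    exact mul_le_of_le_one_right (norm_nonneg y) (pow_le_one₀ (norm_nonneg q) hq.le)
  refine ((hα.norm.mul_of_nonneg hg (fun _ => norm_nonneg _) hg0).mul_right K).of_norm_bounded
    fun ⟨r, m⟩ => ?_
  have hsplit : baileyTerm α c d q a b r m =
      homPoch c a q r * homPoch d b q r * α r *
        (homPoch (c * q ^ r) a q m * homPoch (d * q ^ r) b q m) *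
        ((qPoch q q m)⁻¹ * (qPoch (c * d) q (2 * r + m))⁻¹) := by
    rw [baileyTerm, homPoch_add, homPoch_add]
    ring
  rw [hsplit, norm_mul, norm_mul (_ * α r)]
  gcongr
  · exact mul_nonneg (norm_nonneg _) (hg0 m)
  · exact hle le_rfl le_rfl (hpow c r) (hpow d r) m
  · exact hK m (2 * r + m)

theorem hasSum_sum_antidiagonal {A E : Type*} [AddCommMonoid A] [HasAntidiagonal A]
    [AddCommMonoid E] [TopologicalSpace E] [ContinuousAdd E] [RegularSpace E] {f : A × A → E}
    {s : E} (hf : HasSum f s) : HasSum (fun n => ∑ p ∈ antidiagonal n, f p) s :=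
  (HasAntidiagonal.sigmaAntidiagonalEquivProd.hasSum_iff.mpr hf).sigma fun n =>
    (antidiagonal n).hasSum f

/-- Bailey's lemma, with `ρ₁ = c/a` and `ρ₂ = d/b` in the usual notation. -/
theorem IsBaileyPair.hasSum (h : IsBaileyPair x q α β) (hq : ‖q‖ < 1) (hxcd : c * d = x * q)
    (hcd : ∀ k : ℕ, c * d * q ^ k ≠ 1) (had : ∀ k : ℕ, a * d * q ^ k ≠ 1)
    (hbc : ∀ k : ℕ, b * c * q ^ k ≠ 1) (hab : ‖a * b‖ < 1)
    (hα : Summable fun r => homPoch c a q r * homPoch d b q r * α r) :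
    HasSum (fun n => homPoch c a q n * homPoch d b q n * β n)
      (qPochInf (a * d) q * qPochInf (b * c) q / (qPochInf (c * d) q * qPochInf (a * b) q) *
        ∑' r, homPoch c a q r * homPoch d b q r * α r *
          ((qPoch (a * d) q r)⁻¹ * (qPoch (b * c) q r)⁻¹)) := by
  have hdouble := (summable_baileyTerm hq hcd hab hα).hasSum
  have hcolumns := (hdouble.prod_fiberwise (hasSum_baileyTerm hq hcd had hbc hab α)).tsum_eq
  rw [← tsum_mul_left, hcolumns]
  simpa only [h.sum_antidiagonal_baileyTerm hxcd] using hasSum_sum_antidiagonal hdouble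

end BaileyLemma

section BilateralSum

/-- `1 / (q; q)_k`, extended by zero to negative `k`. -/
noncomputable def invQPoch (q : ℂ) : ℤ → ℂ
  | (k : ℕ) => (qPoch q q k)⁻¹
  | Int.negSucc _ => 0

/-- The `j`-th term of `∑_j (-1)^j q^(3j² + sj) / ((q; q)_{k-2j} (q; q)_{l+2j})`, zero for all but
finitely many `j`. -/
noncomputable def bilatTerm (q : ℂ) (s k l j : ℤ) : ℂ :=
  (-1) ^ j * q ^ (3 * j ^ 2 + s * j) * (invQPoch q (k - 2 * j) * invQPoch q (l + 2 * j))

/-- The bilateral sum `T(s; k, l)`; it is finite, and is written as a `tsum` so that it can be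
reindexed over `ℤ`. -/
noncomputable def bilatSum (q : ℂ) (s k l : ℤ) : ℂ := ∑' j, bilatTerm q s k l j

variable {q : ℂ}

theorem invQPoch_natCast (q : ℂ) (n : ℕ) : invQPoch q n = (qPoch q q n)⁻¹ := rfl

theorem invQPoch_of_neg (q : ℂ) {k : ℤ} (hk : k < 0) : invQPoch q k = 0 := by
  obtain ⟨n, rfl⟩ := Int.eq_negSucc_of_lt_zero hk
  rfl

theorem invQPoch_sub_one (hq : ∀ k : ℕ, q * q ^ k ≠ 1) (k : ℤ) :
    invQPoch q (k - 1) = (1 - q ^ k) * invQPoch q k := by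
  rcases lt_trichotomy k 0 with hneg | rfl | hpos
  · rw [invQPoch_of_neg q hneg, invQPoch_of_neg q (by omega), mul_zero]
  · rw [invQPoch_of_neg q (by omega), zpow_zero, sub_self, zero_mul]
  · obtain ⟨n, rfl⟩ : ∃ n : ℕ, k = (n + 1 : ℕ) := ⟨(k - 1).toNat, by omega⟩
    have hqn : 1 - q * q ^ n ≠ 0 := sub_ne_zero.mpr (hq n).symm
    rw [Nat.cast_succ, add_sub_cancel_right, ← Nat.cast_succ, invQPoch_natCast, invQPoch_natCast,
      zpow_natCast, qPoch_succ, pow_succ', mul_inv, mul_left_comm, mul_inv_cancel₀ hqn, mul_one]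

theorem bilatTerm_eq_zero (q : ℂ) (s : ℤ) {k l j : ℤ} (hj : k - 2 * j < 0 ∨ l + 2 * j < 0) :
    bilatTerm q s k l j = 0 := by
  rcases hj with hk | hl
  · rw [bilatTerm, invQPoch_of_neg q hk, zero_mul, mul_zero]
  · rw [bilatTerm, invQPoch_of_neg q hl, mul_zero, mul_zero]

theorem summable_bilatTerm (q : ℂ) (s k l : ℤ) : Summable (bilatTerm q s k l) :=
  summable_of_ne_finset_zero (s := Icc (-|l|) |k|) fun j hj => bilatTerm_eq_zero q s <| by
    rw [mem_Icc] at hj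
    have := le_abs_self k
    have := le_abs_self l
    have := abs_nonneg k
    have := abs_nonneg l
    omega

theorem bilatSum_swap (q : ℂ) (s k l : ℤ) : bilatSum q s k l = bilatSum q (-s) l k := by
  rw [bilatSum, ← (Equiv.neg ℤ).tsum_eq]
  refine tsum_congr fun j => ?_
  have hsign : (-1 : ℂ) ^ (-j) = (-1) ^ j := by rw [zpow_neg, ← inv_zpow, inv_neg_one]
  simp only [bilatTerm, Equiv.neg_apply, hsign, neg_sq, neg_mul, mul_neg, sub_neg_eq_add,
    ← sub_eq_add_neg]
  ring

theorem neg_one_zpow_neg_one_sub {K : Type*} [Field K] (j : ℤ) :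
    (-1 : K) ^ (-1 - j) = -(-1) ^ j := by
  rw [zpow_sub₀ (neg_ne_zero.mpr one_ne_zero), div_eq_mul_inv, ← inv_zpow, zpow_neg_one,
    inv_neg_one, neg_one_mul]

theorem bilatSum_three_add_two (q : ℂ) (k : ℤ) : bilatSum q 3 k (k + 2) = 0 := by
  refine self_eq_neg.mp ?_
  conv_lhs => rw [bilatSum, ← (Equiv.subLeft (-1 : ℤ)).tsum_eq]
  rw [bilatSum, ← tsum_neg]
  refine tsum_congr fun j => ?_
  simp only [bilatTerm, Equiv.subLeft_apply, neg_one_zpow_neg_one_sub]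
  rw [show 3 * (-1 - j) ^ 2 + 3 * (-1 - j) = 3 * j ^ 2 + 3 * j by ring,
    show k - 2 * (-1 - j) = k + 2 + 2 * j by ring,
    show k + 2 + 2 * (-1 - j) = k - 2 * j by ring]
  ring

theorem bilatSum_sub_one_left (hq0 : q ≠ 0) (hq : ∀ k : ℕ, q * q ^ k ≠ 1) (s k l : ℤ) :
    bilatSum q s (k - 1) l = bilatSum q s k l - q ^ k * bilatSum q (s - 2) k l := by
  rw [bilatSum, bilatSum, bilatSum, ← tsum_mul_left, ← (summable_bilatTerm q s k l).tsum_sub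
    ((summable_bilatTerm q (s - 2) k l).mul_left _)]
  refine tsum_congr fun j => ?_
  have hpow : q ^ k * q ^ (3 * j ^ 2 + (s - 2) * j) =
      q ^ (3 * j ^ 2 + s * j) * q ^ (k - 2 * j) := by
    rw [← zpow_add₀ hq0, ← zpow_add₀ hq0]
    ring_nf
  simp only [bilatTerm]
  rw [sub_right_comm, invQPoch_sub_one hq]
  linear_combination (-1) ^ j * (invQPoch q (k - 2 * j) * invQPoch q (l + 2 * j)) * hpow

theorem bilatSum_sub_one_right (hq0 : q ≠ 0) (hq : ∀ k : ℕ, q * q ^ k ≠ 1) (s k l : ℤ) :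
    bilatSum q s k (l - 1) = bilatSum q s k l - q ^ l * bilatSum q (s + 2) k l := by
  rw [bilatSum_swap, bilatSum_sub_one_left hq0 hq, bilatSum_swap q s, bilatSum_swap q (s + 2),
    neg_add']

theorem bilatSum_three_add_one (hq0 : q ≠ 0) (hq : ∀ k : ℕ, q * q ^ k ≠ 1) (n : ℤ) :
    bilatSum q 3 n (n + 1) = q ^ n * bilatSum q 1 n (n + 1) := by
  have hlower := bilatSum_sub_one_left hq0 hq 3 n (n + 1)
  have hvanish := bilatSum_three_add_two q (n - 1)
  rw [show n - 1 + 2 = n + 1 by ring, hlower] at hvanish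
  exact sub_eq_zero.mp hvanish

theorem bilatSum_neg_one_add_one (hq0 : q ≠ 0) (hq : ∀ k : ℕ, q * q ^ k ≠ 1) (n : ℤ) :
    bilatSum q (-1) n (n + 1) =
      (1 + q ^ (n + 1) - q ^ n * q ^ (n + 1)) * bilatSum q 1 n (n + 1) := by
  have hpos := bilatSum_sub_one_right hq0 hq 1 n (n + 1)
  have hneg := bilatSum_sub_one_right hq0 hq (-1) n (n + 1)
  rw [add_sub_cancel_right, show (1 : ℤ) + 2 = 3 from rfl, bilatSum_three_add_one hq0 hq] at hpos
  rw [add_sub_cancel_right, show (-1 : ℤ) + 2 = 1 from rfl, ← bilatSum_swap] at hneg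
  linear_combination hpos - hneg

theorem bilatSum_one_sub_one (hq0 : q ≠ 0) (hq : ∀ k : ℕ, q * q ^ k ≠ 1) (n : ℤ) :
    bilatSum q 1 (n - 1) n =
      (1 - q ^ n) * (1 - q ^ n * q ^ (n + 1)) * bilatSum q 1 n (n + 1) := by
  have hright := bilatSum_sub_one_right hq0 hq 1 (n - 1) (n + 1)
  have hleft := bilatSum_sub_one_left hq0 hq 1 n (n + 1)
  have hvanish := bilatSum_three_add_two q (n - 1)
  rw [show n - 1 + 2 = n + 1 by ring] at hvanish
  rw [add_sub_cancel_right, show (1 : ℤ) + 2 = 3 from rfl, hvanish] at hright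
  rw [show (1 : ℤ) - 2 = -1 from rfl, bilatSum_neg_one_add_one hq0 hq] at hleft
  linear_combination hright + hleft

theorem bilatSum_one_zero (q : ℂ) : bilatSum q 1 0 1 = (1 - q)⁻¹ := by
  rw [bilatSum, tsum_eq_single 0 fun j hj => bilatTerm_eq_zero q 1 (by omega)]
  have h0 : invQPoch q 0 = 1 := by rw [← Nat.cast_zero, invQPoch_natCast, qPoch_zero, inv_one]
  have h1 : invQPoch q 1 = (1 - q)⁻¹ := by
    rw [← Nat.cast_one, invQPoch_natCast, qPoch_succ, qPoch_zero, pow_zero, mul_one, one_mul]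
  simp only [bilatTerm, mul_zero, zpow_zero, ne_eq, OfNat.ofNat_ne_zero, not_false_eq_true,
    zero_pow, add_zero, sub_zero, h0, h1, one_mul]

theorem mul_sq_pow_ne_one (hq : ∀ k : ℕ, q * q ^ k ≠ 1) (k : ℕ) : q * (q ^ 2) ^ k ≠ 1 := by
  rw [← pow_mul]
  exact hq (2 * k)

theorem bilatSum_one_add_one (hq0 : q ≠ 0) (hq : ∀ k : ℕ, q * q ^ k ≠ 1) (n : ℕ) :
    bilatSum q 1 n (n + 1) = (qPoch q q n * qPoch q (q ^ 2) (n + 1))⁻¹ := by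
  induction n with
  | zero =>
    simp only [Nat.cast_zero, zero_add, bilatSum_one_zero, qPoch_succ, qPoch_zero, pow_zero,
      mul_one, one_mul]
  | succ n ih =>
    have hrec := bilatSum_one_sub_one hq0 hq (n + 1)
    have hfst : q ^ ((n : ℤ) + 1) = q * q ^ n := by
      rw [zpow_add_one₀ hq0, zpow_natCast, mul_comm]
    have hsnd : q ^ ((n : ℤ) + 1) * q ^ ((n : ℤ) + 1 + 1) = q * (q ^ 2) ^ (n + 1) := by
      rw [zpow_add_one₀ hq0 (n + 1), hfst]
      ring
    have hne := mul_ne_zero (sub_ne_zero.mpr (hq n).symm)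
      (sub_ne_zero.mpr (mul_sq_pow_ne_one hq (n + 1)).symm)
    rw [add_sub_cancel_right, ih, hsnd, hfst] at hrec
    apply mul_left_cancel₀ hne
    rw [Nat.cast_succ, ← hrec, qPoch_succ q q n, qPoch_succ _ _ (n + 1), mul_mul_mul_comm,
      mul_inv_rev (qPoch q q n * _), mul_inv_cancel_left₀ hne]

end BilateralSum


section BaileyPair

/-- The sequence `α` of the Bailey pair. It lists the coefficients `(-1)^j q^(3j² + j)` of the
bilateral sum in the order `j = 0, -1, 1, -2, 2, …`. -/
def baileyAlpha {R : Type*} [Ring R] (q : R) (r : ℕ) : R :=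
  if Even r then (-1) ^ (r / 2) * q ^ (3 * (r / 2) ^ 2 + r / 2)
  else (-1) ^ (r / 2 + 1) * q ^ (3 * (r / 2) ^ 2 + 5 * (r / 2) + 2)

theorem baileyAlpha_even {R : Type*} [Ring R] (q : R) (m : ℕ) :
    baileyAlpha q (2 * m) = (-1) ^ m * q ^ (3 * m ^ 2 + m) := by
  rw [baileyAlpha, if_pos (even_two_mul m), Nat.mul_div_cancel_left m two_pos]

theorem baileyAlpha_odd {R : Type*} [Ring R] (q : R) (m : ℕ) :
    baileyAlpha q (2 * m + 1) = (-1) ^ (m + 1) * q ^ (3 * m ^ 2 + 5 * m + 2) := by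
  rw [baileyAlpha, if_neg (by simp), show (2 * m + 1) / 2 = m by omega]

theorem baileyAlpha_zero_succ {R : Type*} [Ring R] (r : ℕ) : baileyAlpha (0 : R) (r + 1) = 0 := by
  obtain ⟨m, hm | hm⟩ := Nat.even_or_odd' (r + 1)
  · rw [hm, baileyAlpha_even, zero_pow (by omega), mul_zero]
  · rw [hm, baileyAlpha_odd, zero_pow (by omega), mul_zero]

theorem norm_baileyAlpha_le_one {𝕜 : Type*} [NormedField 𝕜] {q : 𝕜} (hq : ‖q‖ ≤ 1) (r : ℕ) :
    ‖baileyAlpha q r‖ ≤ 1 := by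
  unfold baileyAlpha
  split_ifs <;>
    simpa only [norm_mul, norm_pow, norm_neg, norm_one, one_pow, one_mul] using
      pow_le_one₀ (norm_nonneg q) hq

variable {q : ℂ}

theorem baileyAlpha_even_mul_invQPoch (q : ℂ) (n m : ℕ) :
    baileyAlpha q (2 * m) *
        (invQPoch q (n - (2 * m : ℕ)) * invQPoch q (n + 1 + (2 * m : ℕ))) =
      bilatTerm q 1 n (n + 1) m := by
  rw [baileyAlpha_even, bilatTerm, zpow_natCast, ← zpow_natCast q]
  push_cast
  ring_nf

theorem baileyAlpha_odd_mul_invQPoch (q : ℂ) (n m : ℕ) :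
    baileyAlpha q (2 * m + 1) *
        (invQPoch q (n - (2 * m + 1 : ℕ)) * invQPoch q (n + 1 + (2 * m + 1 : ℕ))) =
      bilatTerm q 1 n (n + 1) (-(m + 1 : ℤ)) := by
  have hsign : (-1 : ℂ) ^ (-(m + 1 : ℤ)) = (-1) ^ (m + 1) := by
    rw [zpow_neg, ← inv_zpow, inv_neg_one, ← Nat.cast_succ, zpow_natCast]
  have hfst : (n : ℤ) - (2 * m + 1 : ℕ) = n + 1 + 2 * (-(m + 1)) := by push_cast; ring
  have hsnd : (n : ℤ) + 1 + (2 * m + 1 : ℕ) = n - 2 * (-(m + 1)) := by push_cast; ring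
  rw [baileyAlpha_odd, bilatTerm, hsign, ← zpow_natCast q, hfst, hsnd,
    mul_comm (invQPoch q (n + 1 + _))]
  push_cast
  ring_nf

theorem sum_baileyAlpha_eq_bilatSum (q : ℂ) (n : ℕ) :
    ∑ r ∈ range (n + 1), baileyAlpha q r * ((qPoch q q (n - r))⁻¹ * (qPoch q q (n + 1 + r))⁻¹) =
      bilatSum q 1 n (n + 1) := by
  have hs := summable_bilatTerm q 1 n (n + 1)
  have hpos := (hs.comp_injective Nat.cast_injective).hasSum
  have hneg := (hs.comp_injective (i := fun m : ℕ => -(m + 1 : ℤ)) fun _ _ h => by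
    simpa using h).hasSum
  have hall : HasSum
      (fun r : ℕ => baileyAlpha q r * (invQPoch q (n - r) * invQPoch q (n + 1 + r)))
      (bilatSum q 1 n (n + 1)) := by
    rw [bilatSum, (hpos.of_nat_of_neg_add_one hneg).tsum_eq]
    refine HasSum.even_add_odd ?_ ?_
    · simp only [baileyAlpha_even_mul_invQPoch]
      exact hpos
    · simp only [baileyAlpha_odd_mul_invQPoch]
      exact hneg
  rw [← hall.tsum_eq, tsum_eq_sum fun r hr => ?_]
  · refine sum_congr rfl fun r hr => ?_
    rw [← invQPoch_natCast, ← invQPoch_natCast, Nat.cast_sub (mem_range_succ_iff.mp hr)]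
    push_cast
    rfl
  · rw [mem_range] at hr
    rw [invQPoch_of_neg q (by omega), zero_mul, mul_zero]

theorem isBaileyPair_baileyAlpha (hq : ∀ k : ℕ, q * q ^ k ≠ 1) :
    IsBaileyPair q q (baileyAlpha q)
      fun n => (qPoch q q n)⁻¹ * (qPoch (q ^ 3) (q ^ 2) n)⁻¹ := by
  intro n
  rcases eq_or_ne q 0 with rfl | hq0
  · rw [sum_range_succ', sum_eq_zero fun r _ => by rw [baileyAlpha_zero_succ, zero_mul]]
    simp [baileyAlpha, qPoch]
  · have hq1 : 1 - q ≠ 0 := sub_ne_zero.mpr fun h => hq 0 (by rw [← h, one_pow, mul_one])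
    have hsum := sum_baileyAlpha_eq_bilatSum q n
    rw [bilatSum_one_add_one hq0 hq, qPoch_succ', ← pow_succ', mul_left_comm, mul_inv] at hsum
    apply mul_left_cancel₀ (inv_ne_zero hq1)
    beta_reduce
    rw [← mul_inv, ← hsum, mul_sum]
    refine sum_congr rfl fun r _ => ?_
    rw [add_right_comm, qPoch_succ', mul_inv (1 - q)]
    ring

end BaileyPair

section Transformation

/-- The terms of the `α`-side of Bailey's lemma for the pair of `isBaileyPair_baileyAlpha`, with
`ρ₁ = q/a` and `ρ₂ = q/b`. -/
noncomputable def alphaTerm (q a b : ℂ) (r : ℕ) : ℂ :=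
  homPoch q a q r * homPoch q b q r * baileyAlpha q r *
    ((qPoch (a * q) q r)⁻¹ * (qPoch (b * q) q r)⁻¹)

/-- The terms of the `β`-side of Bailey's lemma for the pair of `isBaileyPair_baileyAlpha`, with
`ρ₁ = q/a` and `ρ₂ = q/b`. -/
noncomputable def betaTerm (q a b : ℂ) (n : ℕ) : ℂ :=
  homPoch q a q n * homPoch q b q n * ((qPoch q q n)⁻¹ * (qPoch (q ^ 3) (q ^ 2) n)⁻¹)

variable {q a b : ℂ}

theorem summable_alphaTerm (hq : ‖q‖ < 1) (ha : ∀ k : ℕ, a * q * q ^ k ≠ 1)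
    (hb : ∀ k : ℕ, b * q * q ^ k ≠ 1) (hab : ‖a * b‖ < 1) : Summable (alphaTerm q a b) := by
  obtain ⟨K, hK⟩ := exists_norm_inv_qPoch_mul_inv_qPoch_le ha hb hq hq
  refine (summable_homPoch_mul_homPoch_mul hq hab q q
    (w := fun r => baileyAlpha q r * ((qPoch (a * q) q r)⁻¹ * (qPoch (b * q) q r)⁻¹)) (K := K)
    fun r => ?_).congr fun r => (mul_assoc _ _ _).symm
  rw [norm_mul]
  exact (mul_le_of_le_one_left (norm_nonneg _) (norm_baileyAlpha_le_one hq.le r)).trans (hK r r)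

theorem hasSum_betaTerm (hq : ‖q‖ < 1) (ha : ∀ k : ℕ, a * q * q ^ k ≠ 1)
    (hb : ∀ k : ℕ, b * q * q ^ k ≠ 1) (hab : ‖a * b‖ < 1) :
    HasSum (betaTerm q a b)
      (qPochInf (a * q) q * qPochInf (b * q) q / (qPochInf (q ^ 2) q * qPochInf (a * b) q) *
        ∑' r, alphaTerm q a b r) := by
  rw [pow_two]
  have hqq : ‖q * q‖ < 1 := by rw [← pow_two]; exact norm_sq_lt_one hq
  exact (isBaileyPair_baileyAlpha (mul_pow_ne_one hq hq.le)).hasSum hq rfl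
    (mul_pow_ne_one hqq hq.le) ha hb hab
    (summable_homPoch_mul_homPoch_mul hq hab q q (norm_baileyAlpha_le_one hq.le))

theorem qPochInf_div_mul_tsum_betaTerm (hq : ‖q‖ < 1) (ha : ∀ k : ℕ, a * q * q ^ k ≠ 1)
    (hb : ∀ k : ℕ, b * q * q ^ k ≠ 1) (hab : ‖a * b‖ < 1) :
    qPochInf (q ^ 2) q * qPochInf (a * b) q /
        (qPochInf (-q) q * qPochInf (a * q) q * qPochInf (b * q) q * qPochInf q (q ^ 2)) *
      ∑' n, betaTerm q a b n = ∑' r, alphaTerm q a b r := by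
  have hden : qPochInf (-q) q * qPochInf (a * q) q * qPochInf (b * q) q * qPochInf q (q ^ 2) =
      qPochInf (a * q) q * qPochInf (b * q) q := by
    linear_combination qPochInf (a * q) q * qPochInf (b * q) q * qPochInf_neg_mul_qPochInf_sq hq
  have ha0 := qPochInf_ne_zero ha hq
  have hb0 := qPochInf_ne_zero hb hq
  have hab0 := qPochInf_ne_zero (mul_pow_ne_one hab hq.le) hq
  have hq0 := qPochInf_ne_zero (mul_pow_ne_one (norm_sq_lt_one hq) hq.le) hq
  rw [hden, (hasSum_betaTerm hq ha hb hab).tsum_eq, ← mul_assoc, div_mul_div_cancel₀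
    (mul_ne_zero ha0 hb0), div_self (mul_ne_zero hq0 hab0), one_mul]

theorem qPochPow_mul_div_eq_betaTerm (q a b : ℂ) (n : ℕ) :
    qPochPow q a n * qPochPow q b n /
      (qPoch (q ^ 2) (q ^ 2) n * qPoch (q ^ 3) (q ^ 2) n * qPoch (-q ^ 3) (q ^ 2) n) =
    betaTerm (q ^ 2) a b n := by
  rw [betaTerm, qPochPow_eq_homPoch, qPochPow_eq_homPoch, mul_assoc (qPoch _ _ _),
    qPoch_mul_qPoch_neg, pow_right_comm, div_eq_mul_inv, mul_inv]

theorem neg_one_pow_mul_qPochPow_div_eq_alphaTerm_even (q a b : ℂ) (n : ℕ) :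
    (-1 : ℂ) ^ n *
      (qPochPow q a (2 * n) * qPochPow q b (2 * n) /
        (qPoch (a * q ^ 2) (q ^ 2) (2 * n) * qPoch (b * q ^ 2) (q ^ 2) (2 * n))) *
      q ^ (6 * n ^ 2 + 2 * n) = alphaTerm (q ^ 2) a b (2 * n) := by
  rw [alphaTerm, baileyAlpha_even, qPochPow_eq_homPoch, qPochPow_eq_homPoch, ← pow_mul q]
  ring

theorem neg_one_pow_mul_qPochPow_div_eq_neg_alphaTerm_odd (q a b : ℂ) (n : ℕ) :
    (-1 : ℂ) ^ n *
      (qPochPow q a (2 * n + 1) * qPochPow q b (2 * n + 1) /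
        (qPoch (a * q ^ 2) (q ^ 2) (2 * n + 1) * qPoch (b * q ^ 2) (q ^ 2) (2 * n + 1))) *
      q ^ (6 * n ^ 2 + 10 * n + 4) = -alphaTerm (q ^ 2) a b (2 * n + 1) := by
  rw [alphaTerm, baileyAlpha_odd, qPochPow_eq_homPoch, qPochPow_eq_homPoch, ← pow_mul q]
  ring

end Transformation

theorem theoremT7_general (q a b : ℂ) (hq : ‖q‖ < 1)
    (ha : ∀ k : ℕ, a * q ^ 2 * (q ^ 2) ^ k ≠ 1)
    (hb : ∀ k : ℕ, b * q ^ 2 * (q ^ 2) ^ k ≠ 1) (hab : ‖a * b‖ < 1) :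
    Summable (fun n : ℕ => qPochPow q a n * qPochPow q b n /
      (qPoch (q ^ 2) (q ^ 2) n * qPoch (q ^ 3) (q ^ 2) n * qPoch (-q ^ 3) (q ^ 2) n)) ∧
    Summable (fun n : ℕ => (-1 : ℂ) ^ n *
      (qPochPow q a (2 * n) * qPochPow q b (2 * n) /
        (qPoch (a * q ^ 2) (q ^ 2) (2 * n) * qPoch (b * q ^ 2) (q ^ 2) (2 * n))) *
      q ^ (6 * n ^ 2 + 2 * n)) ∧
    Summable (fun n : ℕ => (-1 : ℂ) ^ n *
      (qPochPow q a (2 * n + 1) * qPochPow q b (2 * n + 1) /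
        (qPoch (a * q ^ 2) (q ^ 2) (2 * n + 1) * qPoch (b * q ^ 2) (q ^ 2) (2 * n + 1))) *
      q ^ (6 * n ^ 2 + 10 * n + 4)) ∧
    qPochInf (q ^ 4) (q ^ 2) * qPochInf (a * b) (q ^ 2) /
        (qPochInf (-q ^ 2) (q ^ 2) * qPochInf (a * q ^ 2) (q ^ 2) *
          qPochInf (b * q ^ 2) (q ^ 2) * qPochInf (q ^ 2) (q ^ 4)) *
      ∑' n : ℕ, qPochPow q a n * qPochPow q b n /
        (qPoch (q ^ 2) (q ^ 2) n * qPoch (q ^ 3) (q ^ 2) n * qPoch (-q ^ 3) (q ^ 2) n) =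
    (∑' n : ℕ, (-1 : ℂ) ^ n *
      (qPochPow q a (2 * n) * qPochPow q b (2 * n) /
        (qPoch (a * q ^ 2) (q ^ 2) (2 * n) * qPoch (b * q ^ 2) (q ^ 2) (2 * n))) *
      q ^ (6 * n ^ 2 + 2 * n)) -
    ∑' n : ℕ, (-1 : ℂ) ^ n *
      (qPochPow q a (2 * n + 1) * qPochPow q b (2 * n + 1) /
        (qPoch (a * q ^ 2) (q ^ 2) (2 * n + 1) * qPoch (b * q ^ 2) (q ^ 2) (2 * n + 1))) *
      q ^ (6 * n ^ 2 + 10 * n + 4) := by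
  have hp := norm_sq_lt_one hq
  have hα := summable_alphaTerm hp ha hb hab
  have heven := hα.comp_injective (mul_right_injective₀ (two_ne_zero' ℕ))
  have hodd := hα.comp_injective
    ((add_left_injective 1).comp (mul_right_injective₀ (two_ne_zero' ℕ)))
  simp only [qPochPow_mul_div_eq_betaTerm, neg_one_pow_mul_qPochPow_div_eq_alphaTerm_even,
    neg_one_pow_mul_qPochPow_div_eq_neg_alphaTerm_odd]
  refine ⟨(hasSum_betaTerm hp ha hb hab).summable, heven, hodd.neg, ?_⟩
  rw [tsum_neg, sub_neg_eq_add, tsum_even_add_odd heven hodd,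
    ← qPochInf_div_mul_tsum_betaTerm hp ha hb hab, ← pow_mul]

theorem theoremT7 (q a b : ℂ) (hq : ‖q‖ < 1)
    (ha : ‖a * q ^ 2‖ < 1) (hb : ‖b * q ^ 2‖ < 1) (hab : ‖a * b‖ < 1) :
    Summable (fun n : ℕ => qPochPow q a n * qPochPow q b n /
      (qPoch (q ^ 2) (q ^ 2) n * qPoch (q ^ 3) (q ^ 2) n * qPoch (-q ^ 3) (q ^ 2) n)) ∧
    Summable (fun n : ℕ => (-1 : ℂ) ^ n *
      (qPochPow q a (2 * n) * qPochPow q b (2 * n) /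
        (qPoch (a * q ^ 2) (q ^ 2) (2 * n) * qPoch (b * q ^ 2) (q ^ 2) (2 * n))) *
      q ^ (6 * n ^ 2 + 2 * n)) ∧
    Summable (fun n : ℕ => (-1 : ℂ) ^ n *
      (qPochPow q a (2 * n + 1) * qPochPow q b (2 * n + 1) /
        (qPoch (a * q ^ 2) (q ^ 2) (2 * n + 1) * qPoch (b * q ^ 2) (q ^ 2) (2 * n + 1))) *
      q ^ (6 * n ^ 2 + 10 * n + 4)) ∧
    qPochInf (q ^ 4) (q ^ 2) * qPochInf (a * b) (q ^ 2) /
        (qPochInf (-q ^ 2) (q ^ 2) * qPochInf (a * q ^ 2) (q ^ 2) *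
          qPochInf (b * q ^ 2) (q ^ 2) * qPochInf (q ^ 2) (q ^ 4)) *
      ∑' n : ℕ, qPochPow q a n * qPochPow q b n /
        (qPoch (q ^ 2) (q ^ 2) n * qPoch (q ^ 3) (q ^ 2) n * qPoch (-q ^ 3) (q ^ 2) n) =
    (∑' n : ℕ, (-1 : ℂ) ^ n *
      (qPochPow q a (2 * n) * qPochPow q b (2 * n) /
        (qPoch (a * q ^ 2) (q ^ 2) (2 * n) * qPoch (b * q ^ 2) (q ^ 2) (2 * n))) *
      q ^ (6 * n ^ 2 + 2 * n)) -
    ∑' n : ℕ, (-1 : ℂ) ^ n *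
      (qPochPow q a (2 * n + 1) * qPochPow q b (2 * n + 1) /
        (qPoch (a * q ^ 2) (q ^ 2) (2 * n + 1) * qPoch (b * q ^ 2) (q ^ 2) (2 * n + 1))) *
      q ^ (6 * n ^ 2 + 10 * n + 4) := by
  have hp := norm_sq_lt_one hq
  exact theoremT7_general q a b hq (mul_pow_ne_one ha hp.le) (mul_pow_ne_one hb hp.le) hab
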